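/- Let $(\Omega,\Sigma,\mathbb P)$ be a probability space. **(A)** Let $(Z_n)_{n\ge 0}$ be independent, identically distributed real random variables on $\Omega$ with $\mathbb P(Z_1>0)=1$, let $y_0\in(0,\infty)$, and put $Y_n=y_0\prod_{i=0}^{n-1}Z_i$. (i) If $\ln Z_1$ is integrable, then $$\mathbb E(\ln Z_1)<0\ \Longrightarrow\ Y_n\to 0 \text{ in probability}\ \Longrightarrow\ \mathbb E(\ln Z_1)\le 0 .$$ (ii) If $\ln Z_1$ is square-integrable, then $$Y_n\to 0 \text{ almost surely}\ \Longleftrightarrow\ \mathbb E(\ln Z_1)<0\ \Longleftrightarrow\ Y_n\to 0\text{ in probability}.$$ **(B)** Let $(\tau_j)_{j\ge1}$ be independent random variables on $\Omega$, uniformly distributed on $[0,1]$. Let $h>0$, $t_j=jh$ for $j\ge 0$, and $\eta\in\mathbb C\setminus\{0\}$. For $z\in\mathbb C$ let $(V^k)_{k\ge 0}$ be the randomized two-stage Runge–Kutta approximation with step size $h$ of $v'=f(t,v)$, $v(0)=\eta$, where $f(t,v)=\lambda v$ and $\lambda=z/h$; that is, $V^0=\eta$ and, for $j\ge1$, $$V^j_\tau=V^{j-1}+h\tau_j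 f(t_{j-1},V^{j-1}),\qquad V^j=V^{j-1}+h f(t_{j-1}+\tau_jh,\,V^j_\tau),$$ so that $V^k=\eta\prod_{j=1}^k p_j(z)$ with $p_j(z)=\tau_jz^2+z+1$. Let $\mathcal R^{MS}$, $\mathcal R^{AS}$, $\mathcal R^{SP}$ be the sets of all $z\in\mathbb C$ for which $V^k\to0$ as $k\to\infty$ in $L^2(\Omega)$, almost surely, and in probability, respectively, and let $\mathcal R^{Mid}=\{z\in\mathbb C:\ |\tfrac12z^2+z+1|^2<1\}$. Then for every $z\in\mathbb C$ one has $\mathbb P(|p_1(z)|>0)=1$ and $\ln|p_1(z)|$ is square-integrable, and $$\mathcal R^{SP}=\{z\in\mathbb C:\ \mathbb E(\ln|p_1(z)|)<0\}=\mathcal R^{AS},\qquad \mathcal R^{MS}\subseteq\mathcal R^{AS}\cap\mathcal R^{Mid}.$$ -/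

import Mathlib

open MeasureTheory ProbabilityTheory Filter Topology

namespace RandRK

/-- The randomized two-stage Runge-Kutta scheme (exact information) for `v' = f t v`, `v 0 = η`, on
the mesh `t_j = j * h`. The argument `s` is the realisation of the random numbers, indexed from
`0`: `s j` is the number used in the step from `t_j` to `t_{j+1}` (often written `τ_{j+1}`). -/
noncomputable def scheme {E : Type*} [AddCommGroup E] [Module ℝ E]
    (f : ℝ → E → E) (h : ℝ) (η : E) (s : ℕ → ℝ) : ℕ → E
  | 0 => η
  | j + 1 =>
      scheme f h η s j +
        h • f ((j : ℝ) * h + s j * h)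
          (scheme f h η s j + (h * s j) • f ((j : ℝ) * h) (scheme f h η s j))

/-- The quadratic polynomial `p(z) = t z² + z + 1` with coefficient `t`. -/
noncomputable def poly (t : ℝ) (z : ℂ) : ℂ := (t : ℂ) * z ^ 2 + z + 1

/-- `V^k`: the scheme with step size `h` applied to the test problem `v' = l v`, `v 0 = η`, where
`l = z / h`, so that `z = h l`. -/
noncomputable def V {Ω : Type*} (τ : ℕ → Ω → ℝ) (h : ℝ) (η z : ℂ) (k : ℕ) (ω : Ω) : ℂ :=
  scheme (fun _ v => (z / (h : ℂ)) * v) h η (fun j => τ j ω) k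

/-- The closed form of `V^k`; in particular it depends on `h` and `l` only through `z = h l`. -/
theorem V_eq_prod {Ω : Type*} (τ : ℕ → Ω → ℝ) {h : ℝ} (hh : 0 < h) (η z : ℂ) (k : ℕ) (ω : Ω) :
    V τ h η z k ω = η * ∏ j ∈ Finset.range k, poly (τ j ω) z := by
  have h0 : (h : ℂ) ≠ 0 := by exact_mod_cast hh.ne'
  induction k with
  | zero => simp [V, scheme]
  | succ k ih =>
    rw [Finset.prod_range_succ, ← mul_assoc, ← ih]
    simp only [V, scheme, poly, Complex.real_smul, Complex.ofReal_mul]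
    field_simp
    ring

/-- The region of mean-square stability: `V^k → 0` in `L²`. -/
def regionMS {Ω : Type*} [MeasurableSpace Ω] (P : Measure Ω) (τ : ℕ → Ω → ℝ) (h : ℝ) (η : ℂ) :
    Set ℂ :=
  {z | Tendsto (fun k => eLpNorm (V τ h η z k) 2 P) atTop (𝓝 0)}

/-- The region of asymptotic stability: `V^k → 0` almost surely. -/
def regionAS {Ω : Type*} [MeasurableSpace Ω] (P : Measure Ω) (τ : ℕ → Ω → ℝ) (h : ℝ) (η : ℂ) :
    Set ℂ :=
  {z | ∀ᵐ ω ∂P, Tendsto (fun k => V τ h η z k ω) atTop (𝓝 0)}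

/-- The region of stability in probability: `V^k → 0` in probability. -/
def regionSP {Ω : Type*} [MeasurableSpace Ω] (P : Measure Ω) (τ : ℕ → Ω → ℝ) (h : ℝ) (η : ℂ) :
    Set ℂ :=
  {z | TendstoInMeasure P (V τ h η z) atTop (fun _ => 0)}

/-- The region of absolute stability of the deterministic midpoint scheme. -/
def regionMid : Set ℂ := {z | ‖(1 / 2 : ℂ) * z ^ 2 + z + 1‖ ^ 2 < 1}

end RandRK

/-! Taking logarithms turns the products into random walks with i.i.d. steps `log (Z i)`. By the
strong law, a negative mean drives the walk to `-∞` and the product to `0`; a positive mean drives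
the product to `∞`, which rules out convergence in probability. The critical case is mean zero: by
the central limit theorem (`not_tendsto_measure_sum_nonneg`) the walk is nonnegative with
probability not tending to `0`, and then the product is at least `1`. Only this case needs
square-integrability.

The stability regions are the case `Z j = ‖poly (τ j) z‖`, `y = ‖η‖`. `memLp_log_norm_poly` applies
the theory to every `z`: for `z ≠ 0` the polynomial is affine in `t`, so its logarithm has at most
one logarithmic singularity. Mean-square stability is compared with the others through convergence
in probability, and with the midpoint scheme through the means. -/

namespace RandRK

/-! ### Products of i.i.d. positive variables -/

section Products

variable {Ω : Type*} [MeasurableSpace Ω] {P : Measure Ω} {Z : ℕ → Ω → ℝ}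

/-- Products of identically distributed, almost surely positive random variables are exponentials
of the partial sums of their logarithms. -/
theorem ae_prod_eq_exp_sum_log (hident : ∀ i, IdentDistrib (Z i) (Z 0) P P)
    (hpos : ∀ᵐ ω ∂P, 0 < Z 0 ω) :
    ∀ᵐ ω ∂P, ∀ n, ∏ i ∈ Finset.range n, Z i ω =
      Real.exp (∑ i ∈ Finset.range n, Real.log (Z i ω)) := by
  have h : ∀ᵐ ω ∂P, ∀ i, 0 < Z i ω :=
    ae_all_iff.2 fun i => (hident i).symm.ae_snd (p := fun x => 0 < x) measurableSet_Ioi hpos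
  filter_upwards [h] with ω hω n
  rw [Real.exp_sum]
  exact Finset.prod_congr rfl fun i _ => (Real.exp_log (hω i)).symm

theorem ae_tendsto_average_log (hindep : iIndepFun Z P)
    (hident : ∀ i, IdentDistrib (Z i) (Z 0) P P)
    (hint : Integrable (fun ω => Real.log (Z 0 ω)) P) :
    ∀ᵐ ω ∂P, Tendsto (fun n : ℕ => (∑ i ∈ Finset.range n, Real.log (Z i ω)) / n) atTop
      (𝓝 (∫ ω, Real.log (Z 0 ω) ∂P)) :=
  strong_law_ae_real (fun i ω => Real.log (Z i ω)) hint
    (fun _ _ hij => (hindep.indepFun hij).comp Real.measurable_log Real.measurable_log)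
    (fun i => (hident i).comp Real.measurable_log)

/-- If the expected logarithm is negative, the products converge to `0` almost surely. -/
theorem ae_tendsto_prod_zero (hindep : iIndepFun Z P)
    (hident : ∀ i, IdentDistrib (Z i) (Z 0) P P) (hpos : ∀ᵐ ω ∂P, 0 < Z 0 ω)
    (hint : Integrable (fun ω => Real.log (Z 0 ω)) P)
    (hneg : ∫ ω, Real.log (Z 0 ω) ∂P < 0) (y : ℝ) :
    ∀ᵐ ω ∂P, Tendsto (fun n => (∏ i ∈ Finset.range n, Z i ω) * y) atTop (𝓝 0) := by
  filter_upwards [ae_prod_eq_exp_sum_log hident hpos, ae_tendsto_average_log hindep hident hint]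
    with ω hω hlim
  have hbot : Tendsto (fun n : ℕ => ∑ i ∈ Finset.range n, Real.log (Z i ω)) atTop atBot := by
    refine (hlim.neg_mul_atTop hneg tendsto_natCast_atTop_atTop).congr' ?_
    filter_upwards [eventually_gt_atTop 0] with n hn
    field_simp
  simpa [hω] using (Real.tendsto_exp_atBot.comp hbot).mul_const y

theorem aemeasurable_prod_mul (hident : ∀ i, IdentDistrib (Z i) (Z 0) P P) (y : ℝ) (n : ℕ) :
    AEMeasurable (fun ω => (∏ i ∈ Finset.range n, Z i ω) * y) P :=
  (Finset.aemeasurable_fun_prod _ fun i _ => (hident i).aemeasurable_fst).mul_const y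

theorem tendstoInMeasure_prod_of_ae [IsFiniteMeasure P]
    (hident : ∀ i, IdentDistrib (Z i) (Z 0) P P) {y : ℝ}
    (h : ∀ᵐ ω ∂P, Tendsto (fun n => (∏ i ∈ Finset.range n, Z i ω) * y) atTop (𝓝 0)) :
    TendstoInMeasure P (fun n ω => (∏ i ∈ Finset.range n, Z i ω) * y) atTop
      (fun _ => (0 : ℝ)) :=
  tendstoInMeasure_of_tendsto_ae
    (fun n => (aemeasurable_prod_mul hident y n).aestronglyMeasurable) h

/-- If the products converge to `0` in probability, the expected logarithm is nonpositive. -/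
theorem integral_log_nonpos_of_tendstoInMeasure [IsProbabilityMeasure P] (hindep : iIndepFun Z P)
    (hident : ∀ i, IdentDistrib (Z i) (Z 0) P P) (hpos : ∀ᵐ ω ∂P, 0 < Z 0 ω)
    (hint : Integrable (fun ω => Real.log (Z 0 ω)) P) {y : ℝ} (hy : 0 < y)
    (h : TendstoInMeasure P (fun n ω => (∏ i ∈ Finset.range n, Z i ω) * y) atTop
      (fun _ => (0 : ℝ))) :
    ∫ ω, Real.log (Z 0 ω) ∂P ≤ 0 := by
  by_contra! hE
  -- An almost surely convergent subsequence lets one sample point carry both the strong law and the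
  -- limit `0`.
  obtain ⟨ns, hns, hns'⟩ := h.exists_seq_tendsto_ae
  obtain ⟨ω, hω, hlim, hzero⟩ := (ae_prod_eq_exp_sum_log hident hpos |>.and <|
    (ae_tendsto_average_log hindep hident hint).and hns').exists
  have htop : Tendsto (fun n : ℕ => ∑ i ∈ Finset.range n, Real.log (Z i ω)) atTop atTop := by
    refine (hlim.pos_mul_atTop hE tendsto_natCast_atTop_atTop).congr' ?_
    filter_upwards [eventually_gt_atTop 0] with n hn
    field_simp
  have hprod : Tendsto (fun n => (∏ i ∈ Finset.range n, Z i ω) * y) atTop atTop := by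
    simpa [hω] using (Real.tendsto_exp_atTop.comp htop).atTop_mul_const hy
  exact not_tendsto_nhds_of_tendsto_atTop (hprod.comp hns.tendsto_atTop) 0 hzero

/-- The partial sums of centred, square-integrable i.i.d. random variables are not negative with
probability tending to one. -/
theorem not_tendsto_measure_sum_nonneg [IsProbabilityMeasure P] {X : ℕ → Ω → ℝ}
    (hindep : iIndepFun X P) (hident : ∀ i, IdentDistrib (X i) (X 0) P P)
    (hX : MemLp (X 0) 2 P) (h0 : ∫ ω, X 0 ω ∂P = 0) :
    ¬ Tendsto (fun n : ℕ => P {ω | 0 ≤ ∑ i ∈ Finset.range n, X i ω}) atTop (𝓝 0) := by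
  intro hlim
  -- With zero variance the Gaussian limit is a point mass at `0` and gives the open half-line no
  -- mass, so this case is separate.
  obtain hv | hv := eq_or_ne Var[X 0; P] 0
  · have hzero : ∀ᵐ ω ∂P, X 0 ω = 0 := by
      simpa [h0] using ae_eq_integral_of_variance_eq_zero hX hv
    have hall : ∀ᵐ ω ∂P, ∀ i, X i ω = 0 := ae_all_iff.2 fun i =>
      (hident i).symm.ae_snd (p := fun x => x = 0) (measurableSet_singleton 0) hzero
    have hone (n : ℕ) : P {ω | 0 ≤ ∑ i ∈ Finset.range n, X i ω} = 1 := by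
      rw [← measure_univ (μ := P)]
      refine measure_congr (eventuallyEq_set.2 ?_)
      filter_upwards [hall] with ω hω
      simp [hω]
    simp only [hone] at hlim
    exact one_ne_zero (tendsto_nhds_unique tendsto_const_nhds hlim)
  · have hv' : Var[X 0; P].toNNReal ≠ 0 := by
      simpa using lt_of_le_of_ne (variance_nonneg _ _) hv.symm
    have hclt := tendstoInDistribution_inv_sqrt_mul_sum_sub
      (Y := id) (P' := gaussianReal 0 Var[X 0; P].toNNReal) HasLaw.id hX hindep hident
    -- Portmanteau: the positive Gaussian mass of `Ioi 0` bounds the liminf from below.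
    have hle := ProbabilityMeasure.le_liminf_measure_open_of_tendsto hclt.tendsto
      (isOpen_Ioi (a := (0 : ℝ)))
    have hgauss : gaussianReal 0 Var[X 0; P].toNNReal (Set.Ioi 0) ≠ 0 := fun h => by
      simpa using gaussianReal_absolutelyContinuous' 0 hv' h
    refine hgauss (le_antisymm ?_ bot_le)
    simp only [ProbabilityMeasure.coe_mk, Measure.map_id] at hle
    refine hle.trans ?_
    rw [← hlim.liminf_eq]
    refine liminf_le_liminf (Eventually.of_forall fun n => ?_)
    rw [Measure.map_apply_of_aemeasurable (hclt.forall_aemeasurable n) measurableSet_Ioi]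
    refine measure_mono fun ω hω => ?_
    simp only [h0, mul_zero, sub_zero, Set.mem_preimage, Set.mem_Ioi] at hω
    exact (pos_of_mul_pos_right hω (by positivity)).le

/-- If the logarithms are square-integrable and the products converge to `0` in probability, the
expected logarithm is negative. -/
theorem integral_log_neg_of_tendstoInMeasure [IsProbabilityMeasure P] (hindep : iIndepFun Z P)
    (hident : ∀ i, IdentDistrib (Z i) (Z 0) P P) (hpos : ∀ᵐ ω ∂P, 0 < Z 0 ω)
    (hL2 : MemLp (fun ω => Real.log (Z 0 ω)) 2 P) {y : ℝ} (hy : 0 < y)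
    (h : TendstoInMeasure P (fun n ω => (∏ i ∈ Finset.range n, Z i ω) * y) atTop
      (fun _ => (0 : ℝ))) :
    ∫ ω, Real.log (Z 0 ω) ∂P < 0 := by
  refine lt_of_le_of_ne (integral_log_nonpos_of_tendstoInMeasure hindep hident hpos
    (hL2.integrable one_le_two) hy h) fun h0 => ?_
  refine not_tendsto_measure_sum_nonneg (X := fun i ω => Real.log (Z i ω))
    (hindep.comp (fun _ => Real.log) fun _ => Real.measurable_log)
    (fun i => (hident i).comp Real.measurable_log) hL2 h0 ?_
  -- The threshold is `y` itself: a nonnegative sum of logarithms makes the product at least `1`.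
  refine tendsto_of_tendsto_of_tendsto_of_le_of_le tendsto_const_nhds
    (tendstoInMeasure_iff_norm.1 h y hy) (fun _ => bot_le) fun n => measure_mono_ae ?_
  filter_upwards [ae_prod_eq_exp_sum_log hident hpos] with ω hω hsum
  change y ≤ ‖(∏ i ∈ Finset.range n, Z i ω) * y - 0‖
  rw [hω n, sub_zero, Real.norm_of_nonneg (by positivity)]
  exact le_mul_of_one_le_left hy.le (Real.one_le_exp hsum)

end Products

/-! ### Logarithmic moments and mean of the random polynomial -/

section Uniform

/-- Any exponent in `(-1, 0)` would stay integrable at a simple zero; `-1/2` comes from squaring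
`|log u| * u ^ (1/4) < 4`, whence the `16`. The term `u ^ 2` covers `u ≥ 1`. -/
theorem log_sq_le {u : ℝ} (hu : 0 < u) : Real.log u ^ 2 ≤ 16 * u ^ (-(1 / 2) : ℝ) + u ^ 2 := by
  have hpow : 0 < u ^ (-(1 / 2) : ℝ) := Real.rpow_pos_of_pos hu _
  obtain h | h := le_total u 1
  · have h1 := Real.abs_log_mul_self_rpow_lt u (1 / 4) hu h (by norm_num)
    have h2 : (Real.log u * u ^ (1 / 4 : ℝ)) ^ 2 ≤ 16 := by
      rw [← sq_abs]
      calc |Real.log u * u ^ (1 / 4 : ℝ)| ^ 2 ≤ (1 / (1 / 4)) ^ 2 := by gcongr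
        _ = 16 := by norm_num
    have h3 : (u ^ (1 / 4 : ℝ)) ^ 2 * u ^ (-(1 / 2) : ℝ) = 1 := by
      rw [← Real.rpow_natCast, ← Real.rpow_mul hu.le, ← Real.rpow_add hu]
      norm_num
    calc Real.log u ^ 2 = (Real.log u * u ^ (1 / 4 : ℝ)) ^ 2 * u ^ (-(1 / 2) : ℝ) := by
          rw [mul_pow, mul_assoc, h3, mul_one]
      _ ≤ 16 * u ^ (-(1 / 2) : ℝ) := by gcongr
      _ ≤ _ := le_add_of_nonneg_right (sq_nonneg u)
  · have h1 := Real.log_nonneg h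
    have h2 := Real.log_le_self hu.le
    nlinarith

theorem integrableOn_abs_sub_rpow (a : ℝ) :
    IntegrableOn (fun t : ℝ => |t - a| ^ (-(1 / 2) : ℝ)) (Set.Icc 0 1) := by
  rw [integrableOn_Icc_iff_integrableOn_Ioc, ← intervalIntegrable_iff_integrableOn_Ioc_of_le
    zero_le_one]
  -- The norm of the complex power is `|x| ^ r` on both sides of `0`, so the singularity may lie
  -- inside the interval.
  have h := ((intervalIntegral.intervalIntegrable_cpow' (a := 0 - a) (b := 1 - a)
    (r := ((-(1 / 2) : ℝ) : ℂ)) (by norm_num)).norm).comp_sub_right a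
  simpa only [Complex.norm_cpow_real, Complex.norm_real, Real.norm_eq_abs, sub_add_cancel] using h

theorem continuous_poly (z : ℂ) : Continuous fun t : ℝ => poly t z := by
  unfold poly
  fun_prop

/-- As a function of `t` the polynomial is `z ^ 2 * (t - c)`; for real `t` the distance to `c` is at
least that to its real part. -/
theorem le_norm_poly {z : ℂ} (hz : z ≠ 0) :
    ∃ a : ℝ, ∀ t : ℝ, ‖z‖ ^ 2 * |t - a| ≤ ‖poly t z‖ := by
  refine ⟨(-(z + 1) / z ^ 2).re, fun t => ?_⟩
  have h : poly t z = z ^ 2 * ((t : ℂ) - -(z + 1) / z ^ 2) := by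
    unfold poly
    field_simp
    ring
  rw [h, norm_mul, norm_pow]
  gcongr
  exact Complex.abs_re_le_norm ((t : ℂ) - -(z + 1) / z ^ 2)

theorem ae_norm_poly_pos (z : ℂ) : ∀ᵐ t : ℝ, 0 < ‖poly t z‖ := by
  obtain rfl | hz := eq_or_ne z 0
  · simp [poly]
  · obtain ⟨a, ha⟩ := le_norm_poly hz
    filter_upwards [compl_mem_ae_iff.2 (measure_singleton a)] with t ht
    have : 0 < |t - a| := abs_pos.2 (sub_ne_zero.2 ht)
    exact lt_of_lt_of_le (by positivity) (ha t)

/-- `log |p|` is square-integrable over the unit interval. -/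
theorem memLp_log_norm_poly (z : ℂ) :
    MemLp (fun t : ℝ => Real.log ‖poly t z‖) 2 (volume.restrict (Set.Icc 0 1)) := by
  obtain rfl | hz := eq_or_ne z 0
  · simp [poly]
  obtain ⟨a, ha⟩ := le_norm_poly hz
  have hmeas : AEStronglyMeasurable (fun t : ℝ => Real.log ‖poly t z‖)
      (volume.restrict (Set.Icc 0 1)) :=
    (Real.measurable_log.comp (continuous_poly z).norm.measurable).aestronglyMeasurable
  rw [memLp_two_iff_integrable_sq hmeas]
  have hbound : IntegrableOn (fun t : ℝ => 16 * ((‖z‖ ^ 2) ^ (-(1 / 2) : ℝ) *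
      |t - a| ^ (-(1 / 2) : ℝ)) + ‖poly t z‖ ^ 2) (Set.Icc 0 1) :=
    (((integrableOn_abs_sub_rpow a).const_mul _).const_mul _).add
      (((continuous_poly z).norm.pow 2).continuousOn.integrableOn_compact isCompact_Icc)
  refine hbound.mono' (hmeas.pow 2) (ae_restrict_of_ae ?_)
  filter_upwards [ae_norm_poly_pos z, compl_mem_ae_iff.2 (measure_singleton a)] with t hpos ht
  have hta : 0 < |t - a| := abs_pos.2 (sub_ne_zero.2 ht)
  rw [Real.norm_of_nonneg (sq_nonneg _)]
  refine (log_sq_le hpos).trans ?_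
  rw [← Real.mul_rpow (by positivity) hta.le]
  gcongr 16 * ?_ + _
  exact Real.rpow_le_rpow_of_nonpos (by positivity) (ha t) (by norm_num)

variable {Ω : Type*} [MeasurableSpace Ω] {P : Measure Ω}

theorem aemeasurable_of_isUniform {T : Ω → ℝ} (hT : pdf.IsUniform T (Set.Icc 0 1) P volume) :
    AEMeasurable T P :=
  hT.aemeasurable (by simp) (by simp)

theorem map_eq_of_isUniform {T : Ω → ℝ} (hT : pdf.IsUniform T (Set.Icc 0 1) P volume) :
    P.map T = volume.restrict (Set.Icc 0 1) := by
  rw [hT, ProbabilityTheory.cond]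
  simp

theorem ae_norm_poly_pos_of_isUniform {T : Ω → ℝ}
    (hT : pdf.IsUniform T (Set.Icc 0 1) P volume) (z : ℂ) :
    ∀ᵐ ω ∂P, 0 < ‖poly (T ω) z‖ :=
  ae_of_ae_map (aemeasurable_of_isUniform hT) (hT.absolutelyContinuous (ae_norm_poly_pos z))

theorem memLp_log_norm_poly_of_isUniform {T : Ω → ℝ}
    (hT : pdf.IsUniform T (Set.Icc 0 1) P volume) (z : ℂ) :
    MemLp (fun ω => Real.log ‖poly (T ω) z‖) 2 P :=
  (map_eq_of_isUniform hT ▸ memLp_log_norm_poly z).comp_of_map (aemeasurable_of_isUniform hT)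

theorem integral_poly_of_isUniform {T : Ω → ℝ}
    (hT : pdf.IsUniform T (Set.Icc 0 1) P volume) (z : ℂ) :
    ∫ ω, poly (T ω) z ∂P = 1 / 2 * z ^ 2 + z + 1 := by
  rw [← integral_map (f := fun t : ℝ => poly t z) (aemeasurable_of_isUniform hT)
    (continuous_poly z).aestronglyMeasurable, map_eq_of_isUniform hT, integral_Icc_eq_integral_Ioc,
    ← intervalIntegral.integral_of_le zero_le_one]
  unfold poly
  have h : IntervalIntegrable (fun t : ℝ => (t : ℂ) * z ^ 2) volume 0 1 :=
    Continuous.intervalIntegrable (by fun_prop) _ _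
  rw [intervalIntegral.integral_add (h.add (by simp)) (by simp),
    intervalIntegral.integral_add h (by simp), intervalIntegral.integral_mul_const,
    intervalIntegral.integral_ofReal]
  simp

end Uniform

/-! ### Stability regions -/

section Stability

theorem norm_V {Ω : Type*} {τ : ℕ → Ω → ℝ} {h : ℝ} {η : ℂ} (hh : 0 < h) (z : ℂ) (k : ℕ) (ω : Ω) :
    ‖V τ h η z k ω‖ = (∏ j ∈ Finset.range k, ‖poly (τ j ω) z‖) * ‖η‖ := by
  rw [V_eq_prod τ hh, norm_mul, norm_prod, mul_comm]

variable {Ω : Type*} [MeasurableSpace Ω] {P : Measure Ω} {τ : ℕ → Ω → ℝ} {h : ℝ} {η : ℂ}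

theorem identDistrib_norm_poly (hτ : ∀ j, pdf.IsUniform (τ j) (Set.Icc 0 1) P volume) (z : ℂ)
    (j : ℕ) : IdentDistrib (fun ω => ‖poly (τ j ω) z‖) (fun ω => ‖poly (τ 0 ω) z‖) P P :=
  IdentDistrib.comp (f := τ j) (g := τ 0) (u := fun t => ‖poly t z‖)
    ⟨aemeasurable_of_isUniform (hτ j), aemeasurable_of_isUniform (hτ 0), (hτ j).trans (hτ 0).symm⟩
    (continuous_poly z).norm.measurable

theorem iIndepFun_norm_poly (hindep : iIndepFun τ P) (z : ℂ) :
    iIndepFun (fun j ω => ‖poly (τ j ω) z‖) P :=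
  hindep.comp (fun _ t => ‖poly t z‖) fun _ => (continuous_poly z).norm.measurable

theorem aestronglyMeasurable_V (hτ : ∀ j, pdf.IsUniform (τ j) (Set.Icc 0 1) P volume) (hh : 0 < h)
    (z : ℂ) (k : ℕ) : AEStronglyMeasurable (V τ h η z k) P := by
  rw [show V τ h η z k = fun ω => η * ∏ j ∈ Finset.range k, poly (τ j ω) z from
    funext fun ω => V_eq_prod τ hh η z k ω]
  exact ((Finset.aemeasurable_fun_prod _ fun j _ => (continuous_poly z).measurable.comp_aemeasurable
    (aemeasurable_of_isUniform (hτ j))).const_mul η).aestronglyMeasurable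

theorem mem_regionAS_iff (hh : 0 < h) {z : ℂ} :
    z ∈ regionAS P τ h η ↔ ∀ᵐ ω ∂P, Tendsto
      (fun k => (∏ j ∈ Finset.range k, ‖poly (τ j ω) z‖) * ‖η‖) atTop (𝓝 0) := by
  simp only [regionAS, Set.mem_ofPred_eq, ← norm_V (τ := τ) (η := η) hh z]
  simp only [← tendsto_zero_iff_norm_tendsto_zero]

theorem mem_regionSP_iff (hh : 0 < h) {z : ℂ} :
    z ∈ regionSP P τ h η ↔ TendstoInMeasure P
      (fun k ω => (∏ j ∈ Finset.range k, ‖poly (τ j ω) z‖) * ‖η‖) atTop (fun _ => (0 : ℝ)) := by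
  simp only [regionSP, Set.mem_ofPred_eq, ← norm_V (τ := τ) (η := η) hh z,
    tendstoInMeasure_iff_norm, sub_zero, norm_norm]

theorem integral_V (hindep : iIndepFun τ P)
    (hτ : ∀ j, pdf.IsUniform (τ j) (Set.Icc 0 1) P volume) (hh : 0 < h) (z : ℂ) (k : ℕ) :
    ∫ ω, V τ h η z k ω ∂P = η * (1 / 2 * z ^ 2 + z + 1) ^ k := by
  simp only [V_eq_prod τ hh, integral_const_mul, Finset.prod_range]
  rw [(hindep.precomp Fin.val_injective).integral_fun_prod_comp (X := fun (i : Fin k) ω => τ i ω)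
    (f := fun _ t => poly t z) (fun i => aemeasurable_of_isUniform (hτ i))
    fun _ => (continuous_poly z).aestronglyMeasurable]
  simp [integral_poly_of_isUniform (hτ _)]

theorem regionMS_subset_regionSP (hτ : ∀ j, pdf.IsUniform (τ j) (Set.Icc 0 1) P volume)
    (hh : 0 < h) : regionMS P τ h η ⊆ regionSP P τ h η := fun z hz =>
  tendstoInMeasure_of_tendsto_eLpNorm two_ne_zero (aestronglyMeasurable_V hτ hh z)
    aestronglyMeasurable_const
    (by simpa only [regionMS, Set.mem_ofPred_eq, Pi.sub_def, sub_zero] using hz)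

/-- The `L²` norm dominates the `L¹` norm and hence the modulus of the mean, which by independence
is a geometric sequence whose ratio is the midpoint stability function. -/
theorem regionMS_subset_regionMid [IsProbabilityMeasure P] (hindep : iIndepFun τ P)
    (hτ : ∀ j, pdf.IsUniform (τ j) (Set.Icc 0 1) P volume) (hh : 0 < h) (hη : η ≠ 0) :
    regionMS P τ h η ⊆ regionMid := by
  intro z hz
  have hint : Tendsto (fun k => ∫ ω, V τ h η z k ω ∂P) atTop (𝓝 0) := by
    rw [tendsto_zero_iff_enorm_tendsto_zero]
    refine tendsto_of_tendsto_of_tendsto_of_le_of_le tendsto_const_nhds hz (fun _ => bot_le)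
      fun k => (enorm_integral_le_lintegral_enorm _).trans ?_
    rw [← eLpNorm_one_eq_lintegral_enorm]
    exact eLpNorm_le_eLpNorm_of_exponent_le one_le_two (aestronglyMeasurable_V hτ hh z k)
  simp only [integral_V hindep hτ hh] at hint
  have hpow : Tendsto (fun k => ‖1 / 2 * z ^ 2 + z + 1‖ ^ k) atTop (𝓝 0) := by
    simpa [hη] using (hint.const_mul η⁻¹).norm
  have hlt : ‖1 / 2 * z ^ 2 + z + 1‖ < 1 := by
    simpa using tendsto_pow_atTop_nhds_zero_iff.1 hpow
  exact pow_lt_one₀ (norm_nonneg _) hlt two_ne_zero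

end Stability

end RandRK

theorem lemma5p4 {Ω : Type*} [MeasurableSpace Ω] (P : Measure Ω) [IsProbabilityMeasure P] :
    -- products of i.i.d. positive random variables
    (∀ (Z : ℕ → Ω → ℝ) (y₀ : ℝ), iIndepFun Z P → (∀ i, IdentDistrib (Z i) (Z 1) P P) →
      (∀ᵐ ω ∂P, 0 < Z 1 ω) → 0 < y₀ →
      (Integrable (fun ω => Real.log (Z 1 ω)) P →
        ((∫ ω, Real.log (Z 1 ω) ∂P) < 0 →
          TendstoInMeasure P (fun n ω => (∏ i ∈ Finset.range n, Z i ω) * y₀) atTop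
            (fun _ => (0 : ℝ))) ∧
        (TendstoInMeasure P (fun n ω => (∏ i ∈ Finset.range n, Z i ω) * y₀) atTop
            (fun _ => (0 : ℝ)) →
          (∫ ω, Real.log (Z 1 ω) ∂P) ≤ 0)) ∧
      (MemLp (fun ω => Real.log (Z 1 ω)) 2 P →
        ((∀ᵐ ω ∂P, Tendsto (fun n => (∏ i ∈ Finset.range n, Z i ω) * y₀) atTop (𝓝 0)) ↔
          (∫ ω, Real.log (Z 1 ω) ∂P) < 0) ∧
        ((∫ ω, Real.log (Z 1 ω) ∂P) < 0 ↔
          TendstoInMeasure P (fun n ω => (∏ i ∈ Finset.range n, Z i ω) * y₀) atTop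
            (fun _ => (0 : ℝ))))) ∧
    -- stability regions of the randomized Runge-Kutta method
    (∀ (τ : ℕ → Ω → ℝ) (h : ℝ) (η : ℂ), iIndepFun τ P →
      (∀ j, pdf.IsUniform (τ j) (Set.Icc 0 1) P volume) → 0 < h → η ≠ 0 →
      (∀ z : ℂ, (∀ᵐ ω ∂P, 0 < ‖RandRK.poly (τ 0 ω) z‖) ∧
        MemLp (fun ω => Real.log ‖RandRK.poly (τ 0 ω) z‖) 2 P) ∧
      RandRK.regionSP P τ h η =
        {z : ℂ | (∫ ω, Real.log ‖RandRK.poly (τ 0 ω) z‖ ∂P) < 0} ∧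
      {z : ℂ | (∫ ω, Real.log ‖RandRK.poly (τ 0 ω) z‖ ∂P) < 0} = RandRK.regionAS P τ h η ∧
      RandRK.regionMS P τ h η ⊆ RandRK.regionAS P τ h η ∩ RandRK.regionMid) := by
  refine ⟨fun Z y₀ hindep hident hpos hy => ?_, fun τ h η hindep hτ hh hη => ?_⟩
  -- The statement takes `Z 1` as reference variable, the lemmas take `Z 0`.
  · have hident0 (i : ℕ) : IdentDistrib (Z i) (Z 0) P P := (hident i).trans (hident 0).symm
    have hpos0 : ∀ᵐ ω ∂P, 0 < Z 0 ω :=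
      (hident 0).symm.ae_snd (p := fun x => 0 < x) measurableSet_Ioi hpos
    have hlog := (hident 0).comp Real.measurable_log
    have hE : ∫ ω, Real.log (Z 1 ω) ∂P = ∫ ω, Real.log (Z 0 ω) ∂P := hlog.integral_eq.symm
    rw [hE]
    have ae_of_neg (hint : Integrable (fun ω => Real.log (Z 1 ω)) P) :=
      fun hneg => RandRK.ae_tendsto_prod_zero hindep hident0 hpos0
        (hlog.integrable_iff.2 hint) hneg y₀
    refine ⟨fun hint => ⟨fun hneg => RandRK.tendstoInMeasure_prod_of_ae hident0
      (ae_of_neg hint hneg), RandRK.integral_log_nonpos_of_tendstoInMeasure hindep hident0 hpos0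
        (hlog.integrable_iff.2 hint) hy⟩, fun hL2 => ?_⟩
    have neg_of_measure := RandRK.integral_log_neg_of_tendstoInMeasure hindep hident0 hpos0
      (hlog.memLp_iff.2 hL2) hy
    have ae_of_neg := ae_of_neg (hL2.integrable one_le_two)
    exact ⟨⟨fun hae => neg_of_measure (RandRK.tendstoInMeasure_prod_of_ae hident0 hae), ae_of_neg⟩,
      fun hneg => RandRK.tendstoInMeasure_prod_of_ae hident0 (ae_of_neg hneg), neg_of_measure⟩
  · have hident := RandRK.identDistrib_norm_poly hτ
    have hpos := RandRK.ae_norm_poly_pos_of_isUniform (hτ 0)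
    have hL2 := RandRK.memLp_log_norm_poly_of_isUniform (hτ 0)
    have hindep' := RandRK.iIndepFun_norm_poly hindep
    have neg_of_SP (z : ℂ) (hz : z ∈ RandRK.regionSP P τ h η) :
        ∫ ω, Real.log ‖RandRK.poly (τ 0 ω) z‖ ∂P < 0 :=
      RandRK.integral_log_neg_of_tendstoInMeasure (hindep' z) (hident z) (hpos z) (hL2 z)
        (norm_pos_iff.2 hη) ((RandRK.mem_regionSP_iff hh).1 hz)
    have AS_of_neg (z : ℂ) (hz : ∫ ω, Real.log ‖RandRK.poly (τ 0 ω) z‖ ∂P < 0) :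
        z ∈ RandRK.regionAS P τ h η :=
      (RandRK.mem_regionAS_iff hh).2 (RandRK.ae_tendsto_prod_zero (hindep' z) (hident z) (hpos z)
        ((hL2 z).integrable one_le_two) hz _)
    have SP_of_AS (z : ℂ) (hz : z ∈ RandRK.regionAS P τ h η) : z ∈ RandRK.regionSP P τ h η :=
      (RandRK.mem_regionSP_iff hh).2 (RandRK.tendstoInMeasure_prod_of_ae (hident z)
        ((RandRK.mem_regionAS_iff hh).1 hz))
    exact ⟨fun z => ⟨hpos z, hL2 z⟩,
      Set.Subset.antisymm neg_of_SP fun z hz => SP_of_AS z (AS_of_neg z hz),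
      Set.Subset.antisymm AS_of_neg fun z hz => neg_of_SP z (SP_of_AS z hz),
      fun z hz => ⟨AS_of_neg z (neg_of_SP z (RandRK.regionMS_subset_regionSP hτ hh hz)),
        RandRK.regionMS_subset_regionMid hindep hτ hh hη hz⟩⟩
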